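/- For $1<p<\infty$ let $J_p$ be the James space $$J_p=\Big\{x:\mathbb N\to\mathbb R \;:\; x(n)\to 0 \text{ and } \|x\|_{J_p}=\sup_{p_1<\dots<p_n}\Big(\sum_{i=1}^{n-1}|x(p_{i+1})-x(p_i)|^p\Big)^{1/p}<\infty\Big\},$$ where the supremum is over all nonempty finite increasing sequences of indices in $\mathbb N$, equipped with the norm $\|\cdot\|_{J_p}$. A map $f:(M,d)\to(N,\delta)$ between metric spaces is a coarse Lipschitz embedding if there exist $\theta,A,B>0$ such that for all $x,y\in M$ with $d(x,y)\ge\theta$ one has $A\,d(x,y)\le\delta(f(x),f(y))\le B\,d(x,y)$; if such a map exists, $M$ is said to coarse Lipschitz embed into $N$. Let $1<q<p<\infty$. Then $J_q$ does not coarse Lipschitz embed into $J_p$. -/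

import Mathlib

open Filter Topology

noncomputable section

/-- `f : M → N` is a coarse Lipschitz embedding: it is bi-Lipschitz on all pairs of points whose
distance is at least some threshold `θ`. -/
def IsCoarseLipschitzEmbedding {M N : Type*} [MetricSpace M] [MetricSpace N] (f : M → N) : Prop :=
  ∃ θ A B : ℝ, 0 < θ ∧ 0 < A ∧ 0 < B ∧
    ∀ x y : M, θ ≤ dist x y → A * dist x y ≤ dist (f x) (f y) ∧ dist (f x) (f y) ≤ B * dist x y

/-- `M` coarse Lipschitz embeds into `N`. -/
def CoarseLipschitzEmbeds (M N : Type*) [MetricSpace M] [MetricSpace N] : Prop :=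
  ∃ f : M → N, IsCoarseLipschitzEmbedding f

/-- The set of all numbers `(∑ |x (k (i+1)) - x (k i)| ^ p) ^ (1/p)`, where `k 0 < ⋯ < k n` runs
over all nonempty finite increasing sequences of indices. -/
def jamesVariations (p : ℝ) (x : ℕ → ℝ) : Set ℝ :=
  {s | ∃ (n : ℕ) (k : Fin (n + 1) → ℕ), StrictMono k ∧
    s = (∑ i : Fin n, |x (k i.succ) - x (k i.castSucc)| ^ p) ^ (1 / p)}

/-- The James norm of a sequence: the supremum of its variations. -/
def jamesNorm (p : ℝ) (x : ℕ → ℝ) : ℝ := sSup (jamesVariations p x)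

theorem jamesVariations_nonneg {p : ℝ} {x : ℕ → ℝ} {s : ℝ} (hs : s ∈ jamesVariations p x) :
    0 ≤ s := by
  obtain ⟨n, k, -, rfl⟩ := hs
  positivity

theorem jamesVariations_nonempty (p : ℝ) (x : ℕ → ℝ) : (jamesVariations p x).Nonempty :=
  ⟨_, 0, fun i => (i : ℕ), fun _ _ h => h, rfl⟩

theorem jamesNorm_nonneg (p : ℝ) (x : ℕ → ℝ) : 0 ≤ jamesNorm p x :=
  Real.sSup_nonneg fun _ hs => jamesVariations_nonneg hs

theorem jamesVariations_add_le {p : ℝ} (hp : 1 < p) {x y : ℕ → ℝ}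
    (hx : BddAbove (jamesVariations p x)) (hy : BddAbove (jamesVariations p y)) {s : ℝ}
    (hs : s ∈ jamesVariations p (x + y)) : s ≤ jamesNorm p x + jamesNorm p y := by
  obtain ⟨n, k, hk, rfl⟩ := hs
  have h := Real.Lp_add_le Finset.univ (fun i : Fin n => x (k i.succ) - x (k i.castSucc))
    (fun i : Fin n => y (k i.succ) - y (k i.castSucc)) hp.le
  have e : ∀ i : Fin n, (x + y) (k i.succ) - (x + y) (k i.castSucc)
      = (x (k i.succ) - x (k i.castSucc)) + (y (k i.succ) - y (k i.castSucc)) := by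
    intro i; simp only [Pi.add_apply]; ring
  simp only [e]
  exact h.trans (add_le_add (le_csSup hx ⟨n, k, hk, rfl⟩) (le_csSup hy ⟨n, k, hk, rfl⟩))

theorem jamesVariations_smul_le {p : ℝ} (hp : 1 < p) {x : ℕ → ℝ} (c : ℝ)
    (hx : BddAbove (jamesVariations p x)) {s : ℝ}
    (hs : s ∈ jamesVariations p (c • x)) : s ≤ |c| * jamesNorm p x := by
  obtain ⟨n, k, hk, rfl⟩ := hs
  have e : ∀ i : Fin n, |(c • x) (k i.succ) - (c • x) (k i.castSucc)| ^ p
      = |c| ^ p * |x (k i.succ) - x (k i.castSucc)| ^ p := by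
    intro i
    rw [← Real.mul_rpow (abs_nonneg _) (abs_nonneg _), ← abs_mul]
    simp only [Pi.smul_apply, smul_eq_mul, mul_sub]
  simp only [e]
  rw [← Finset.mul_sum, Real.mul_rpow (by positivity) (by positivity),
    ← Real.rpow_mul (abs_nonneg c), mul_one_div_cancel (by linarith), Real.rpow_one]
  exact mul_le_mul_of_nonneg_left (le_csSup hx ⟨n, k, hk, rfl⟩) (abs_nonneg c)

theorem abs_sub_le_jamesNorm {p : ℝ} (hp : 1 < p) {x : ℕ → ℝ}
    (hx : BddAbove (jamesVariations p x)) {a b : ℕ} (hab : a < b) :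
    |x b - x a| ≤ jamesNorm p x := by
  refine le_csSup hx ⟨1, ![a, b], ?_, ?_⟩
  · intro i j hij
    fin_cases i <;> fin_cases j <;> simp_all
  · simp only [Finset.univ_unique, Fin.default_eq_zero, Finset.sum_singleton]
    rw [← Real.rpow_mul (abs_nonneg _), mul_one_div_cancel (by linarith), Real.rpow_one]
    simp

/-- The real sequences that tend to `0` and have finite James norm, as a linear subspace of all
real sequences. -/
def jamesSubmodule (p : ℝ) [hp : Fact (1 < p)] : Submodule ℝ (ℕ → ℝ) where
  carrier := {x | Tendsto x atTop (𝓝 0) ∧ BddAbove (jamesVariations p x)}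
  add_mem' := fun {x y} hx hy => by
    refine ⟨by have h := hx.1.add hy.1; rwa [add_zero] at h, jamesNorm p x + jamesNorm p y, fun s hs => ?_⟩
    exact jamesVariations_add_le hp.out hx.2 hy.2 hs
  zero_mem' := by
    refine ⟨tendsto_const_nhds, 0, ?_⟩
    rintro s ⟨n, k, -, rfl⟩
    have h0 : p ≠ 0 := by linarith [hp.out]
    simp [Real.zero_rpow h0, h0]
  smul_mem' := fun c x hx => by
    refine ⟨by have h := hx.1.const_smul c; rwa [smul_zero] at h, |c| * jamesNorm p x, fun s hs => ?_⟩
    exact jamesVariations_smul_le hp.out c hx.2 hs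

/-- The James space `J_p` for `1 < p < ∞`. (A type synonym, so that its metric and topology are
those of the James norm and not those of pointwise convergence.) -/
def JamesSpace (p : ℝ) [Fact (1 < p)] : Type := jamesSubmodule p

namespace JamesSpace

variable {p : ℝ} [hp : Fact (1 < p)]

instance : AddCommGroup (JamesSpace p) := inferInstanceAs (AddCommGroup (jamesSubmodule p))

instance : Module ℝ (JamesSpace p) := inferInstanceAs (Module ℝ (jamesSubmodule p))

/-- The underlying sequence of an element of `J_p`. -/
def toSeq (x : JamesSpace p) : ℕ → ℝ := Subtype.val (p := (· ∈ jamesSubmodule p)) x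

instance : Norm (JamesSpace p) := ⟨fun x => jamesNorm p x.toSeq⟩

theorem norm_def (x : JamesSpace p) : ‖x‖ = jamesNorm p x.toSeq := rfl

theorem bddAbove (x : JamesSpace p) : BddAbove (jamesVariations p x.toSeq) :=
  (Subtype.property (p := (· ∈ jamesSubmodule p)) x).2

theorem tendsto (x : JamesSpace p) : Tendsto x.toSeq atTop (𝓝 0) :=
  (Subtype.property (p := (· ∈ jamesSubmodule p)) x).1

theorem toSeq_add (x y : JamesSpace p) : (x + y).toSeq = x.toSeq + y.toSeq := rfl

theorem toSeq_smul (c : ℝ) (x : JamesSpace p) : (c • x).toSeq = c • x.toSeq := rfl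

theorem norm_smul_le' (c : ℝ) (x : JamesSpace p) : ‖c • x‖ ≤ |c| * ‖x‖ :=
  csSup_le (jamesVariations_nonempty _ _) fun _ hs =>
    jamesVariations_smul_le hp.out c x.bddAbove hs

theorem eq_zero_of_norm (x : JamesSpace p) (h : ‖x‖ = 0) : x = 0 := by
  have hc : ∀ b, x.toSeq b = x.toSeq 0 := by
    intro b
    rcases Nat.eq_zero_or_pos b with rfl | hb
    · rfl
    · have := abs_sub_le_jamesNorm hp.out x.bddAbove hb
      rw [← norm_def, h] at this
      exact sub_eq_zero.mp (abs_nonpos_iff.mp this)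
  have h0 : x.toSeq 0 = 0 := by
    have h1 : Tendsto (fun _ : ℕ => x.toSeq 0) atTop (𝓝 0) :=
      x.tendsto.congr hc
    exact tendsto_nhds_unique tendsto_const_nhds h1
  exact Subtype.ext (funext fun b => (hc b).trans h0)

theorem normCore : NormedSpace.Core ℝ (JamesSpace p) where
  norm_nonneg x := jamesNorm_nonneg p x.toSeq
  norm_smul c x := by
    refine le_antisymm (norm_smul_le' c x) ?_
    rcases eq_or_ne c 0 with rfl | hc
    · rw [norm_zero, zero_mul]
      exact jamesNorm_nonneg p _
    · have h := norm_smul_le' c⁻¹ (c • x)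
      rw [inv_smul_smul₀ hc, abs_inv] at h
      rw [Real.norm_eq_abs]
      have hc' : 0 < |c| := abs_pos.mpr hc
      calc |c| * ‖x‖ ≤ |c| * (|c|⁻¹ * ‖c • x‖) := mul_le_mul_of_nonneg_left h hc'.le
        _ = ‖c • x‖ := by field_simp
  norm_triangle x y := csSup_le (jamesVariations_nonempty _ _) fun _ hs =>
    jamesVariations_add_le hp.out x.bddAbove y.bddAbove hs
  norm_eq_zero_iff x := by
    refine ⟨eq_zero_of_norm x, ?_⟩
    rintro rfl
    have h := norm_smul_le' 0 (0 : JamesSpace p)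
    rw [zero_smul, abs_zero, zero_mul] at h
    exact le_antisymm h (jamesNorm_nonneg p _)

instance : NormedAddCommGroup (JamesSpace p) := NormedAddCommGroup.ofCore normCore

instance : NormedSpace ℝ (JamesSpace p) := NormedSpace.ofCore normCore

end JamesSpace

end

/-! Suppose `φ : J_q → J_p` is coarse Lipschitz with threshold `θ`, and put `f(n₁, …, n_k) =
φ(θ(e_{n₁} + ⋯ + e_{n_k}))`. Changing one index moves `f` by at most a constant `r`. For interlaced
`n₁ < m₁ < n₂ < m₂ < ⋯` the two sums of unit vectors are at distance at least `2 k^{1/q}`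
(`two_mul_rpow_le_norm_sub`). In `J_p`, however, some interlaced pair has images at distance at most
`(kK)^{1/p}`, with `K` depending only on `p` and `r` (`exists_interlaced_hasControl_sub`). As `q <
p`, these bounds conflict for large `k`.

The upper bound comes from iterated pointwise limits along an ultrafilter, which act as weak*
limits. The indices are chosen one pair at a time. Fixing `n₁` and `m₁` far out changes the
difference `G` of the two limits very little on a long initial segment, and by a sequence of bounded
variation beyond it, where `G` itself has little variation left. The `p`-th power of the variation
therefore grows by an additive constant `K` (`HasControl.glue`). The limits may leave `J_p`, since
they need not vanish at infinity; `limitProfile` records their values there so that sup bounds do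
not deteriorate with `k`. -/

/-! ### Control functions for the `p`-variation -/

/-- `x` has finite `p`-variation, witnessed by a monotone function with values in `[0, C]` whose
increments dominate the `p`-th powers of the increments of `x`. -/
def HasControl (p C : ℝ) (x : ℕ → ℝ) : Prop :=
  ∃ ω : ℕ → ℝ, Monotone ω ∧ (∀ t, 0 ≤ ω t ∧ ω t ≤ C) ∧
    ∀ a b, a ≤ b → |x b - x a| ^ p ≤ ω b - ω a

theorem abs_add_rpow_le {p : ℝ} (hp : 0 ≤ p) (a b : ℝ) :
    |a + b| ^ p ≤ 2 ^ p * (|a| ^ p + |b| ^ p) := by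
  have key : ∀ a b : ℝ, |a| ≤ |b| → |a + b| ^ p ≤ 2 ^ p * (|a| ^ p + |b| ^ p) := by
    intro a b hab
    calc |a + b| ^ p ≤ (2 * |b|) ^ p := by
          refine Real.rpow_le_rpow (abs_nonneg _) ?_ hp
          linarith [abs_add_le a b]
      _ = 2 ^ p * |b| ^ p := Real.mul_rpow (by norm_num) (abs_nonneg _)
      _ ≤ _ := by
          have : 0 ≤ |a| ^ p := by positivity
          gcongr
          linarith
  rcases le_total |a| |b| with h | h
  · exact key a b h
  · have := key b a h
    rwa [add_comm b a, add_comm (|b| ^ p)] at this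

theorem HasControl.add {p C D : ℝ} (hp : 0 ≤ p) {x y : ℕ → ℝ} (hx : HasControl p C x)
    (hy : HasControl p D y) : HasControl p (2 ^ p * (C + D)) (fun t => x t + y t) := by
  obtain ⟨v, hv, hvb, hvx⟩ := hx
  obtain ⟨w, hw, hwb, hwy⟩ := hy
  have h2 : (0 : ℝ) < 2 ^ p := by positivity
  refine ⟨fun t => 2 ^ p * (v t + w t), ?_, ?_, ?_⟩
  · exact (hv.add hw).const_mul h2.le
  · intro t
    refine ⟨mul_nonneg h2.le (add_nonneg (hvb t).1 (hwb t).1), ?_⟩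
    exact mul_le_mul_of_nonneg_left (add_le_add (hvb t).2 (hwb t).2) h2.le
  · intro a b hab
    have h := abs_add_rpow_le hp (x b - x a) (y b - y a)
    have e : x b + y b - (x a + y a) = (x b - x a) + (y b - y a) := by ring
    rw [e, ← mul_sub]
    refine h.trans (mul_le_mul_of_nonneg_left ?_ h2.le)
    linarith [hvx a b hab, hwy a b hab]

theorem HasControl.neg {p C : ℝ} {x : ℕ → ℝ} (hx : HasControl p C x) :
    HasControl p C (fun t => -x t) := by
  obtain ⟨v, hv, hvb, hvx⟩ := hx
  refine ⟨v, hv, hvb, fun a b hab => ?_⟩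
  have e : -x b - -x a = -(x b - x a) := by ring
  rw [e, abs_neg]
  exact hvx a b hab

theorem HasControl.sub {p C D : ℝ} (hp : 0 ≤ p) {x y : ℕ → ℝ} (hx : HasControl p C x)
    (hy : HasControl p D y) : HasControl p (2 ^ p * (C + D)) (fun t => x t - y t) := by
  simpa only [sub_eq_add_neg] using hx.add hp hy.neg

theorem jamesVariations_le_of_hasControl {p C : ℝ} (hp : 0 < p) {x : ℕ → ℝ}
    (hx : HasControl p C x) {s : ℝ} (hs : s ∈ jamesVariations p x) : s ≤ C ^ (1 / p) := by
  obtain ⟨ω, hω, hωb, hωx⟩ := hx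
  obtain ⟨n, k, hk, rfl⟩ := hs
  refine Real.rpow_le_rpow (by positivity) ?_ (by positivity)
  have htel : ∑ i : Fin n, (ω (k i.succ) - ω (k i.castSucc)) = ω (k (Fin.last n)) - ω (k 0) := by
    rw [Finset.sum_sub_distrib]
    have h1 := Fin.sum_univ_succ (fun i => ω (k i))
    have h2 := Fin.sum_univ_castSucc (fun i => ω (k i))
    linarith
  calc _ ≤ ∑ i : Fin n, (ω (k i.succ) - ω (k i.castSucc)) :=
        Finset.sum_le_sum fun i _ => hωx _ _ (hk.monotone i.castSucc_lt_succ.le)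
    _ = _ := htel
    _ ≤ C := by linarith [(hωb (k (Fin.last n))).2, (hωb (k 0)).1]

/-- The sums of `p`-th powers of increments of `x` along finite increasing sequences of indices,
together with the last index. -/
inductive VariationSum (p : ℝ) (x : ℕ → ℝ) : ℕ → ℝ → Prop
  | single (c : ℕ) : VariationSum p x c 0
  | snoc {c d : ℕ} {s : ℝ} : VariationSum p x c s → c < d →
      VariationSum p x d (s + |x d - x c| ^ p)

theorem VariationSum.exists_strictMono {p : ℝ} {x : ℕ → ℝ} {c : ℕ} {s : ℝ}
    (h : VariationSum p x c s) : ∃ (n : ℕ) (k : Fin (n + 1) → ℕ), StrictMono k ∧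
      k (Fin.last n) = c ∧ s = ∑ i : Fin n, |x (k i.succ) - x (k i.castSucc)| ^ p := by
  induction h with
  | single c => exact ⟨0, fun _ => c, fun i j hij => absurd hij (by omega), rfl, by simp⟩
  | @snoc c d s h hcd ih =>
    obtain ⟨n, k, hk, hkl, rfl⟩ := ih
    refine ⟨n + 1, Fin.snoc (α := fun _ => ℕ) k d, ?_, by simp, ?_⟩
    · rw [Fin.strictMono_iff_lt_succ]
      intro i
      induction i using Fin.lastCases with
      | last => simpa [hkl] using hcd
      | cast i =>
        rw [Fin.succ_castSucc, Fin.snoc_castSucc, Fin.snoc_castSucc]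
        exact hk i.castSucc_lt_succ
    · rw [Fin.sum_univ_castSucc]
      congr 1
      · refine Finset.sum_congr rfl fun i _ => ?_
        rw [Fin.succ_castSucc, Fin.snoc_castSucc, Fin.snoc_castSucc]
      · rw [Fin.succ_last, Fin.snoc_last, Fin.snoc_castSucc, hkl]

theorem VariationSum.le {p : ℝ} (hp : 0 < p) {x : ℕ → ℝ} (hx : BddAbove (jamesVariations p x))
    {c : ℕ} {s : ℝ} (h : VariationSum p x c s) : s ≤ jamesNorm p x ^ p := by
  obtain ⟨n, k, hk, -, rfl⟩ := h.exists_strictMono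
  have h1 := le_csSup hx ⟨n, k, hk, rfl⟩
  have h2 := Real.rpow_le_rpow (by positivity) h1 hp.le
  rwa [← Real.rpow_mul (by positivity), one_div_mul_cancel hp.ne', Real.rpow_one] at h2

/-- The control at `b` is the supremum of the variation sums that end at or before `b`. A sum ending
at or before `a` can be extended through `a` to `b`, which gains at least `|x b - x a| ^ p`. -/
theorem hasControl_of_bddAbove {p : ℝ} (hp : 0 < p) {x : ℕ → ℝ}
    (hx : BddAbove (jamesVariations p x)) : HasControl p (jamesNorm p x ^ p) x := by
  set V : ℕ → Set ℝ := fun b => {s | ∃ c ≤ b, VariationSum p x c s} with hV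
  have hbdd : ∀ b, BddAbove (V b) := fun b =>
    ⟨jamesNorm p x ^ p, by rintro s ⟨c, -, hs⟩; exact hs.le hp hx⟩
  have hne : ∀ b, (V b).Nonempty := fun b => ⟨0, b, le_rfl, .single b⟩
  have hmono : Monotone fun b => sSup (V b) := fun a b hab =>
    csSup_le_csSup (hbdd b) (hne a) fun s ⟨c, hc, hs⟩ => ⟨c, hc.trans hab, hs⟩
  refine ⟨fun b => sSup (V b), hmono, fun b => ⟨?_, ?_⟩, fun a b hab => ?_⟩
  · exact le_csSup (hbdd b) ⟨b, le_rfl, .single b⟩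
  · exact csSup_le (hne b) (by rintro s ⟨c, -, hs⟩; exact hs.le hp hx)
  · rcases hab.eq_or_lt with rfl | hab
    · simp [Real.zero_rpow hp.ne']
    · rw [le_sub_iff_add_le, ← le_sub_iff_add_le']
      refine csSup_le (hne a) ?_
      rintro s ⟨c, hc, hs⟩
      rw [le_sub_iff_add_le']
      rcases hc.eq_or_lt with rfl | hc
      · rw [add_comm]
        exact le_csSup (hbdd b) ⟨b, le_rfl, hs.snoc hab⟩
      · refine le_trans ?_ (le_csSup (hbdd b) ⟨b, le_rfl, (hs.snoc hc).snoc hab⟩)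
        have : 0 ≤ |x a - x c| ^ p := by positivity
        linarith

/-! ### Limits along an ultrafilter -/

/-- The limit of a sequence of reals along a fixed nonprincipal ultrafilter. -/
noncomputable def ulim (u : ℕ → ℝ) : ℝ := limUnder (hyperfilter ℕ : Filter ℕ) u

theorem tendsto_ulim {u : ℕ → ℝ} {S : ℝ} (hu : ∀ n, |u n| ≤ S) :
    Tendsto u (hyperfilter ℕ : Filter ℕ) (𝓝 (ulim u)) := by
  refine tendsto_nhds_limUnder ?_
  obtain ⟨x, -, hx⟩ := (isCompact_Icc (a := -S) (b := S)).ultrafilter_le_nhds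
    ((hyperfilter ℕ).map u) (by
      rw [Ultrafilter.coe_map]
      exact tendsto_principal.2 (Eventually.of_forall fun n => abs_le.1 (hu n)))
  exact ⟨x, hx⟩

theorem ulim_eq {u : ℕ → ℝ} {a : ℝ} (h : Tendsto u (hyperfilter ℕ : Filter ℕ) (𝓝 a)) :
    ulim u = a := h.limUnder_eq

theorem abs_ulim_le {u : ℕ → ℝ} {S : ℝ} (hu : ∀ n, |u n| ≤ S) : |ulim u| ≤ S :=
  le_of_tendsto (tendsto_ulim hu).abs (Eventually.of_forall hu)

theorem ulim_sub {u v : ℕ → ℝ} {S T : ℝ} (hu : ∀ n, |u n| ≤ S) (hv : ∀ n, |v n| ≤ T) :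
    ulim (fun n => u n - v n) = ulim u - ulim v :=
  ulim_eq ((tendsto_ulim hu).sub (tendsto_ulim hv))

theorem ulim_const (a : ℝ) : ulim (fun _ => a) = a := ulim_eq tendsto_const_nhds

/-- The controls are bounded, so they converge along the ultrafilter too, and every condition on
them is closed. Unlike membership in `J_p`, a control thus survives pointwise limits. -/
theorem HasControl.ulim {p C S : ℝ} (hp : 0 < p) {g : ℕ → ℕ → ℝ}
    (hg : ∀ n, HasControl p C (g n)) (hS : ∀ n t, |g n t| ≤ S) :
    HasControl p C (fun t => ulim fun n => g n t) := by
  choose ω hω hωb hωg using hg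
  have hωt : ∀ t, Tendsto (fun n => ω n t) (hyperfilter ℕ : Filter ℕ)
      (𝓝 (_root_.ulim fun n => ω n t)) := fun t =>
    tendsto_ulim (S := C) fun n => by
      rw [abs_of_nonneg (hωb n t).1]; exact (hωb n t).2
  refine ⟨fun t => _root_.ulim fun n => ω n t, fun a b hab => ?_, fun t => ⟨?_, ?_⟩,
    fun a b hab => ?_⟩
  · exact le_of_tendsto_of_tendsto' (hωt a) (hωt b) fun n => hω n hab
  · exact ge_of_tendsto' (hωt t) fun n => (hωb n t).1
  · exact le_of_tendsto' (hωt t) fun n => (hωb n t).2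
  · refine le_of_tendsto_of_tendsto' ?_ ((hωt b).sub (hωt a)) fun n => hωg n a b hab
    exact ((tendsto_ulim fun n => hS n b).sub (tendsto_ulim fun n => hS n a)).abs.rpow_const
      (Or.inr hp.le)

/-- The iterated limit along the ultrafilter of a function of `k` natural numbers. -/
noncomputable def ilim : ℕ → (List ℕ → ℝ) → ℝ
  | 0, F => F []
  | k + 1, F => ulim fun n => ilim k fun l => F (n :: l)

theorem ilim_succ (k : ℕ) (F : List ℕ → ℝ) :
    ilim (k + 1) F = ulim fun n => ilim k fun l => F (n :: l) := rfl

theorem abs_ilim_le {S : ℝ} (k : ℕ) (F : List ℕ → ℝ) (hF : ∀ l, l.length = k → |F l| ≤ S) :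
    |ilim k F| ≤ S := by
  induction k generalizing F with
  | zero => exact hF [] rfl
  | succ k ih => exact abs_ulim_le fun n => ih _ fun l hl => hF _ (by simp [hl])

theorem tendsto_ilim_succ {S : ℝ} (k : ℕ) (F : List ℕ → ℝ)
    (hF : ∀ l, l.length = k + 1 → |F l| ≤ S) :
    Tendsto (fun n => ilim k fun l => F (n :: l)) (hyperfilter ℕ : Filter ℕ)
      (𝓝 (ilim (k + 1) F)) :=
  tendsto_ulim fun _ => abs_ilim_le k _ fun l hl => hF _ (by simp [hl])

theorem ilim_sub {S T : ℝ} (k : ℕ) (F H : List ℕ → ℝ) (hF : ∀ l, l.length = k → |F l| ≤ S)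
    (hH : ∀ l, l.length = k → |H l| ≤ T) :
    ilim k (fun l => F l - H l) = ilim k F - ilim k H := by
  induction k generalizing F H with
  | zero => rfl
  | succ k ih =>
    have hF' : ∀ n l, l.length = k → |F (n :: l)| ≤ S := fun n l hl => hF _ (by simp [hl])
    have hH' : ∀ n l, l.length = k → |H (n :: l)| ≤ T := fun n l hl => hH _ (by simp [hl])
    rw [ilim_succ, ilim_succ, ilim_succ, ← ulim_sub (fun n => abs_ilim_le k _ (hF' n))
      (fun n => abs_ilim_le k _ (hH' n))]
    congr 1
    funext n
    exact ih _ _ (hF' n) (hH' n)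

theorem HasControl.ilim {p C S : ℝ} (hp : 0 < p) (k : ℕ) (f : List ℕ → ℕ → ℝ)
    (hf : ∀ l, l.length = k → HasControl p C (f l)) (hS : ∀ l, l.length = k → ∀ t, |f l t| ≤ S) :
    HasControl p C (fun t => ilim k fun l => f l t) := by
  induction k generalizing f with
  | zero => exact hf [] rfl
  | succ k ih =>
    refine HasControl.ulim (S := S) hp (fun n => ?_) fun n t => ?_
    · exact ih (fun l => f (n :: l)) (fun l hl => hf _ (by simp [hl]))
        (fun l hl => hS _ (by simp [hl]))
    · exact abs_ilim_le k _ fun l hl => hS _ (by simp [hl]) t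

/-! ### Gluing -/

/-- `W` enters with coefficient one, so repeated gluing gives linear growth; `HasControl.add` would
multiply it by `2 ^ p` each time. Up to `N` the sequence `H` imitates `G`, one increment across `N`
costs at most `(2 * S) ^ p`, and beyond `N` both `G` and `H - G` have bounded control. -/
theorem HasControl.glue {p S W Q : ℝ} (hp : 0 < p) {G H : ℕ → ℝ} {Ω : ℕ → ℝ} (hΩ : Monotone Ω)
    (hΩb : ∀ t, 0 ≤ Ω t ∧ Ω t ≤ W) (hΩG : ∀ a b, a ≤ b → |G b - G a| ^ p ≤ Ω b - Ω a)
    (hd : HasControl p Q (fun t => H t - G t)) (hH : ∀ t, |H t| ≤ S) {N : ℕ}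
    (htail : ∀ t, N ≤ t → Ω t - Ω N ≤ 1)
    (hhead : ∀ a ≤ N, ∀ b ≤ N, |H b - H a| ^ p ≤ |G b - G a| ^ p + 1 / (N + 1)) :
    HasControl p (W + (1 + (2 * S) ^ p + 2 ^ p * (1 + Q))) H := by
  obtain ⟨ω, hω, hωb, hωd⟩ := hd
  have hS : 0 ≤ S := (abs_nonneg _).trans (hH 0)
  have hSp : 0 ≤ (2 * S) ^ p := by positivity
  have h2 : (0 : ℝ) < 2 ^ p := by positivity
  have hN : (0 : ℝ) < N + 1 := by positivity
  have hle1 : ∀ t, t ≤ N → (t : ℝ) / (N + 1) ≤ 1 := fun t ht => by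
    rw [div_le_one hN]
    have : (t : ℝ) ≤ N := by exact_mod_cast ht
    linarith
  have h0 : ∀ t : ℕ, (0 : ℝ) ≤ t / (N + 1) := fun t => by positivity
  have hinc : ∀ a b, a ≤ b → 0 ≤ 2 ^ p * ((Ω b - Ω a) + (ω b - ω a)) := fun a b hab =>
    mul_nonneg h2.le (by linarith [hΩ hab, hω hab])
  have hQ : 0 ≤ Q := (hωb 0).1.trans (hωb 0).2
  -- The term `t / (N + 1)` pays the error `1 / (N + 1)` for every pair `a < b ≤ N`, at total cost
  -- below `1`.
  set Φ : ℕ → ℝ := fun t => if t ≤ N then Ω t + t / (N + 1) else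
    Ω N + 1 + (2 * S) ^ p + 2 ^ p * ((Ω t - Ω N) + (ω t - ω N)) with hΦ
  have hctrl : ∀ a b, a < b → |H b - H a| ^ p ≤ Φ b - Φ a := by
    intro a b hab
    by_cases hb : b ≤ N
    · have ha : a ≤ N := hab.le.trans hb
      simp only [hΦ, if_pos ha, if_pos hb]
      have h1 : (1 : ℝ) / (N + 1) ≤ b / (N + 1) - a / (N + 1) := by
        rw [← sub_div]
        have : (a : ℝ) + 1 ≤ b := by exact_mod_cast hab
        gcongr
        linarith
      linarith [hhead a ha b hb, hΩG a b hab.le]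
    · by_cases ha : a ≤ N
      · simp only [hΦ, if_pos ha, if_neg hb]
        have h1 : |H b - H a| ^ p ≤ (2 * S) ^ p := by
          refine Real.rpow_le_rpow (abs_nonneg _) ?_ hp.le
          linarith [abs_sub (H b) (H a), hH a, hH b]
        linarith [hΩ ha, hle1 a ha, hinc N b (by omega)]
      · simp only [hΦ, if_neg ha, if_neg hb]
        have h1 := abs_add_rpow_le hp.le (G b - G a) ((H b - G b) - (H a - G a))
        have e : G b - G a + (H b - G b - (H a - G a)) = H b - H a := by ring
        rw [e] at h1
        have h3 := mul_le_mul_of_nonneg_left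
          (add_le_add (hΩG a b hab.le) (hωd a b hab.le)) h2.le
        linarith
  refine ⟨Φ, fun a b hab => ?_, fun t => ?_, fun a b hab => ?_⟩
  · rcases hab.eq_or_lt with rfl | hab
    · exact le_rfl
    · have : 0 ≤ |H b - H a| ^ p := by positivity
      linarith [hctrl a b hab]
  · by_cases ht : t ≤ N
    · simp only [hΦ, if_pos ht]
      have : 0 ≤ 2 ^ p * (1 + Q) := by positivity
      constructor <;> linarith [hle1 t ht, h0 t, (hΩb t).1, (hΩb t).2]
    · simp only [hΦ, if_neg ht]
      have ht' : N ≤ t := by omega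
      refine ⟨by linarith [hinc N t ht', (hΩb N).1], ?_⟩
      have : 2 ^ p * ((Ω t - Ω N) + (ω t - ω N)) ≤ 2 ^ p * (1 + Q) := by
        refine mul_le_mul_of_nonneg_left ?_ h2.le
        linarith [htail t ht', (hωb t).2, (hωb N).1]
      linarith [(hΩb N).2]
  · rcases hab.eq_or_lt with rfl | hab
    · simp [Real.zero_rpow hp.ne']
    · exact hctrl a b hab

theorem exists_tail_le {Ω : ℕ → ℝ} {W : ℝ} (hΩ : Monotone Ω) (hW : ∀ t, Ω t ≤ W) :
    ∃ N, ∀ a, N ≤ a → ∀ b, a ≤ b → Ω b - Ω a ≤ 1 := by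
  have hb : BddAbove (Set.range Ω) := ⟨W, by rintro _ ⟨t, rfl⟩; exact hW t⟩
  obtain ⟨N, hN⟩ := exists_lt_of_lt_ciSup (show (⨆ t, Ω t) - 1 < ⨆ t, Ω t by linarith)
  exact ⟨N, fun a ha b _ => by linarith [le_ciSup hb b, hΩ ha]⟩

/-- A controlled sequence whose limit is less than `1` is eventually bounded by `2`, with control
increasing by at most `1`. -/
theorem exists_tail_bound {p W S : ℝ} (hp : 0 < p) {G Ω : ℕ → ℝ} (hΩ : Monotone Ω)
    (hΩb : ∀ t, 0 ≤ Ω t ∧ Ω t ≤ W) (hΩG : ∀ a b, a ≤ b → |G b - G a| ^ p ≤ Ω b - Ω a)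
    (hS : ∀ t, |G t| ≤ S) (hlim : |ulim G| < 1) :
    ∃ N, ∀ t, N ≤ t → |G t| ≤ 2 ∧ Ω t - Ω N ≤ 1 := by
  obtain ⟨N, hN⟩ := exists_tail_le hΩ fun t => (hΩb t).2
  have h1 : ∀ᶠ t in (hyperfilter ℕ : Filter ℕ), |G t| < 1 :=
    (tendsto_ulim hS).abs.eventually (gt_mem_nhds hlim)
  obtain ⟨T, hT1, hT⟩ := (h1.and (Nat.hyperfilter_le_atTop (eventually_ge_atTop N))).exists
  refine ⟨T, fun t ht => ⟨?_, hN T hT t ht⟩⟩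
  have h2 : |G t - G T| ≤ 1 := by
    by_contra! h
    have := Real.one_lt_rpow h hp
    linarith [hΩG T t ht, hN T hT t ht]
  have e : G t = (G t - G T) + G T := by ring
  rw [e]
  linarith [abs_add_le (G t - G T) (G T)]


/-! ### Concentration along interlaced sets -/

/-- `l = [n₁, …, n_k]` and `l' = [m₁, …, m_k]` with `N < n₁ < m₁ < n₂ < m₂ < ⋯`. -/
inductive Interlaced : ℕ → List ℕ → List ℕ → Prop
  | nil (N : ℕ) : Interlaced N [] []
  | cons {N n m : ℕ} {l l' : List ℕ} : N < n → n < m → Interlaced m l l' →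
      Interlaced N (n :: l) (m :: l')

/-- `f` takes values in the sequences, and changing one of `k` arguments changes the value by a
sequence with control `R` and bound `r`. -/
def AdjacentControl (p R r : ℝ) (k : ℕ) (f : List ℕ → ℕ → ℝ) : Prop :=
  ∀ (l₁ l₂ : List ℕ) (n n' : ℕ), l₁.length + l₂.length + 1 = k →
    HasControl p R (fun t => f (l₁ ++ n :: l₂) t - f (l₁ ++ n' :: l₂) t) ∧
      ∀ t, |f (l₁ ++ n :: l₂) t - f (l₁ ++ n' :: l₂) t| ≤ r

theorem AdjacentControl.tail {p R r : ℝ} {k : ℕ} {f : List ℕ → ℕ → ℝ}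
    (hf : AdjacentControl p R r (k + 1) f) (n : ℕ) :
    AdjacentControl p R r k (fun l => f (n :: l)) := fun l₁ l₂ a b h =>
  hf (n :: l₁) l₂ a b (by simp only [List.length_cons]; omega)

/-- The difference is itself a limit over `n'` of the effect of replacing the first argument `n` by
`n'`, so it inherits the adjacent bounds. -/
theorem AdjacentControl.ilim_sub_ilim {p R r S : ℝ} (hp : 0 < p) {k : ℕ} {f : List ℕ → ℕ → ℝ}
    (hf : AdjacentControl p R r (k + 1) f) (hS : ∀ l, l.length = k + 1 → ∀ t, |f l t| ≤ S)
    (n : ℕ) :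
    HasControl p R (fun t => ilim k (fun l => f (n :: l) t) - ilim (k + 1) (fun l => f l t)) ∧
      ∀ t, |ilim k (fun l => f (n :: l) t) - ilim (k + 1) (fun l => f l t)| ≤ r := by
  have hS' : ∀ n t l, l.length = k → |f (n :: l) t| ≤ S := fun n t l hl => hS _ (by simp [hl]) t
  have hsub : ∀ n' t, ilim k (fun l => f (n :: l) t) - ilim k (fun l => f (n' :: l) t) =
      ilim k (fun l => f (n :: l) t - f (n' :: l) t) := fun n' t =>
    (ilim_sub k _ _ (hS' n t) (hS' n' t)).symm
  have hadj : ∀ n' (l : List ℕ), l.length = k → _ := fun n' l hl =>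
    hf [] l n n' (by simp [hl])
  have hr : ∀ n' t,
      |ilim k (fun l => f (n :: l) t) - ilim k (fun l => f (n' :: l) t)| ≤ r := fun n' t => by
    rw [hsub]
    exact abs_ilim_le k _ fun l hl => (hadj n' l hl).2 t
  have hlim : ∀ t, ilim k (fun l => f (n :: l) t) - ilim (k + 1) (fun l => f l t) =
      ulim fun n' => ilim k (fun l => f (n :: l) t) - ilim k (fun l => f (n' :: l) t) := fun t => by
    rw [ulim_sub (fun _ => abs_ilim_le k _ (hS' n t)) (fun n' => abs_ilim_le k _ (hS' n' t)),
      ulim_const, ilim_succ]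
  simp only [hlim]
  refine ⟨HasControl.ulim hp (fun n' => ?_) hr, fun t => abs_ulim_le fun n' => hr n' t⟩
  simp only [hsub]
  exact HasControl.ilim hp k (fun l t => f (n :: l) t - f (n' :: l) t)
    (fun l hl => (hadj n' l hl).1) (fun l hl => (hadj n' l hl).2)

/-- The iterated limit over the first `i` arguments of the limit at infinity of the iterated
pointwise limit over the last `j` arguments. -/
noncomputable def limitProfile (i j : ℕ) (f : List ℕ → ℕ → ℝ) : ℝ :=
  ilim i fun l => ulim fun t => ilim j fun l' => f (l ++ l') t

theorem tendsto_limitProfile {S : ℝ} {i j : ℕ} {f : List ℕ → ℕ → ℝ}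
    (hS : ∀ l, l.length = i + 1 + j → ∀ t, |f l t| ≤ S) :
    Tendsto (fun n => limitProfile i j fun l => f (n :: l)) (hyperfilter ℕ : Filter ℕ)
      (𝓝 (limitProfile (i + 1) j f)) :=
  tendsto_ilim_succ (S := S) i _ fun l hl => abs_ulim_le fun t => abs_ilim_le j _ fun l' hl' =>
    hS _ (by simp [hl, hl']) t

/-- Two functions are needed because fixing `n` in one and `m` in the other breaks the symmetry. The
hypothesis on profiles is strict and covers every split `i + j = k`, so that it passes to the
remaining arguments. -/
theorem exists_interlaced_hasControl {p R r : ℝ} (hp : 0 < p) (k : ℕ) :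
    ∀ (f g : List ℕ → ℕ → ℝ) (S W : ℝ) (M : ℕ),
      (∀ l, l.length = k → ∀ t, |f l t| ≤ S) → (∀ l, l.length = k → ∀ t, |g l t| ≤ S) →
      AdjacentControl p R r k f → AdjacentControl p R r k g →
      (∀ i j, i + j = k → |limitProfile i j f - limitProfile i j g| < 1) →
      HasControl p W (fun t => ilim k (fun l => f l t) - ilim k (fun l => g l t)) →
      (∀ t, |ilim k (fun l => f l t) - ilim k (fun l => g l t)| < 2 * r + 3) →
      ∃ l l', Interlaced M l l' ∧ l.length = k ∧ l'.length = k ∧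
        HasControl p (W + k * (1 + (2 * (2 * r + 3)) ^ p + 2 ^ p * (1 + 2 ^ p * (R + R))))
          (fun t => f l t - g l' t) := by
  set K := 1 + (2 * (2 * r + 3)) ^ p + 2 ^ p * (1 + 2 ^ p * (R + R)) with hK
  induction k with
  | zero =>
    intro f g S W M hfS hgS hf hg hprof hW hG
    exact ⟨[], [], .nil M, rfl, rfl, by simpa [ilim] using hW⟩
  | succ k ih =>
    intro f g S W M hfS hgS hf hg hprof hW hG
    set G : ℕ → ℝ := fun t => ilim (k + 1) (fun l => f l t) - ilim (k + 1) (fun l => g l t)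
      with hGdef
    set H : ℕ × ℕ → ℕ → ℝ := fun z t =>
      ilim k (fun l => f (z.1 :: l) t) - ilim k (fun l => g (z.2 :: l) t) with hHdef
    have hfS' : ∀ n l, l.length = k → ∀ t, |f (n :: l) t| ≤ S := fun n l hl => hfS _ (by simp [hl])
    have hgS' : ∀ n l, l.length = k → ∀ t, |g (n :: l) t| ≤ S := fun n l hl => hgS _ (by simp [hl])
    -- The profile with `i = 0` is the value at infinity of the full iterated limit.
    have hGlim : |ulim G| < 1 := by
      have h := hprof 0 (k + 1) (by omega)
      have e : limitProfile 0 (k + 1) f - limitProfile 0 (k + 1) g = ulim G :=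
        (ulim_sub (fun t => abs_ilim_le _ _ fun l hl => hfS l hl t)
          (fun t => abs_ilim_le _ _ fun l hl => hgS l hl t)).symm
      rwa [e] at h
    obtain ⟨Ω, hΩ, hΩb, hΩG⟩ := hW
    obtain ⟨N, hN⟩ := exists_tail_bound hp hΩ hΩb hΩG (fun t => (hG t).le) hGlim
    let U : Filter ℕ := hyperfilter ℕ
    have hHt : ∀ t, Tendsto (fun z => H z t) (U ×ˢ U) (𝓝 (G t)) := fun t =>
      ((tendsto_ilim_succ k _ fun l hl => hfS l hl t).comp tendsto_fst).sub
        ((tendsto_ilim_succ k _ fun l hl => hgS l hl t).comp tendsto_snd)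
    have ev1 : ∀ᶠ z in U ×ˢ U, ∀ t ∈ Set.Iic N, |H z t| < 2 * r + 3 :=
      (Set.finite_Iic N).eventually_all.2 fun t _ =>
        (hHt t).abs.eventually (gt_mem_nhds (hG t))
    have ev2 : ∀ᶠ z in U ×ˢ U, ∀ a ∈ Set.Iic N, ∀ b ∈ Set.Iic N,
        |H z b - H z a| ^ p < |G b - G a| ^ p + 1 / (N + 1) :=
      (Set.finite_Iic N).eventually_all.2 fun a _ => (Set.finite_Iic N).eventually_all.2 fun b _ =>
        ((((hHt b).sub (hHt a)).abs.rpow_const (Or.inr hp.le)).eventually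
          (gt_mem_nhds (lt_add_of_pos_right _ (by positivity))))
    -- Fixing the first argument turns profile `i + 1` into an approximation of it with index `i`.
    have ev3 : ∀ᶠ z in U ×ˢ U, ∀ i ∈ Set.Iic k,
        |limitProfile i (k - i) (fun l => f (z.1 :: l)) -
          limitProfile i (k - i) (fun l => g (z.2 :: l))| < 1 :=
      (Set.finite_Iic k).eventually_all.2 fun i hi => by
        have hi' : i + 1 + (k - i) = k + 1 := by have := Set.mem_Iic.1 hi; omega
        exact (((tendsto_limitProfile fun l hl => hfS l (hl.trans hi')).comp tendsto_fst).sub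
          ((tendsto_limitProfile fun l hl => hgS l (hl.trans hi')).comp tendsto_snd)).abs.eventually
          (gt_mem_nhds (hprof (i + 1) (k - i) hi'))
    have hgt : ∀ a, ∀ᶠ n in U, a < n := fun a => Nat.hyperfilter_le_atTop (eventually_gt_atTop a)
    -- Currying selects `n` before `m`, which leaves room to require `n < m`.
    obtain ⟨n, hn, hMn⟩ := ((ev1.and (ev2.and ev3)).curry.and (hgt M)).exists
    obtain ⟨m, ⟨h1, h2, h3⟩, hnm⟩ := (hn.and (hgt n)).exists
    obtain ⟨hfc, hfr⟩ := hf.ilim_sub_ilim hp hfS n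
    obtain ⟨hgc, hgr⟩ := hg.ilim_sub_ilim hp hgS m
    -- Beyond `N` the bound is rebuilt as `2 + r + r`, whatever it was before; up to `N` it is
    -- inherited by closeness to `G`. Hence `2 * r + 3` is the same at every step.
    have hHS : ∀ t, |H (n, m) t| < 2 * r + 3 := fun t => by
      rcases le_total t N with ht | ht
      · exact h1 t ht
      · have e : H (n, m) t = G t +
            ((ilim k (fun l => f (n :: l) t) - ilim (k + 1) (fun l => f l t)) -
              (ilim k (fun l => g (m :: l) t) - ilim (k + 1) (fun l => g l t))) := by
          simp only [hGdef, hHdef]; ring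
        have b1 := abs_add_le (G t)
          ((ilim k (fun l => f (n :: l) t) - ilim (k + 1) (fun l => f l t)) -
              (ilim k (fun l => g (m :: l) t) - ilim (k + 1) (fun l => g l t)))
        have b2 := abs_sub (ilim k (fun l => f (n :: l) t) - ilim (k + 1) (fun l => f l t))
          (ilim k (fun l => g (m :: l) t) - ilim (k + 1) (fun l => g l t))
        rw [e]
        linarith [hfr t, hgr t, (hN t ht).1]
    have hHc : HasControl p (W + K) (H (n, m)) := by
      refine HasControl.glue hp hΩ hΩb hΩG ?_ (fun t => (hHS t).le) (fun t ht => (hN t ht).2)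
        fun a ha b hb => (h2 a ha b hb).le
      convert hfc.sub hp.le hgc using 2 with t
      simp only [hGdef, hHdef]; ring
    obtain ⟨l, l', hll, hl, hl', hc⟩ := ih (fun l => f (n :: l)) (fun l => g (m :: l)) S (W + K) m
      (hfS' n) (hgS' m) (hf.tail n) (hg.tail m)
      (fun i j hij => by
        have := h3 i (Set.mem_Iic.2 (by omega))
        rwa [show k - i = j by omega] at this) hHc hHS
    refine ⟨n :: l, m :: l', .cons hMn hnm hll, by simp [hl], by simp [hl'], ?_⟩
    convert hc using 1
    push_cast
    ring

/-- For bounded `f` with `AdjacentControl`, the values at some interlaced pair differ by a sequence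
whose control grows linearly in `k`, with a constant not depending on `k`. -/
theorem exists_interlaced_hasControl_sub {p R r S : ℝ} (hp : 0 < p) (hr : 0 ≤ r) (k : ℕ)
    {f : List ℕ → ℕ → ℝ} (hS : ∀ l, l.length = k → ∀ t, |f l t| ≤ S)
    (hf : AdjacentControl p R r k f) :
    ∃ l l', Interlaced 0 l l' ∧ l.length = k ∧ l'.length = k ∧
      HasControl p (k * (1 + (2 * (2 * r + 3)) ^ p + 2 ^ p * (1 + 2 ^ p * (R + R))))
        (fun t => f l t - f l' t) := by
  -- With `g = f` the limits and profiles cancel, so the induction starts from `W = 0`.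
  have h := exists_interlaced_hasControl hp k f f S 0 0 hS hS hf hf (by simp)
    ⟨fun _ => 0, monotone_const, by simp, by simp [Real.zero_rpow hp.ne']⟩
    (fun t => by rw [sub_self, abs_zero]; positivity)
  simpa only [zero_add] using h

/-! ### Sums of unit vectors in James spaces -/

/-- Only the increments from `n_i` to `m_i` are counted; each goes from `1` to `-1`. Prescribing `x`
only beyond `N` lets the induction forget earlier pairs. -/
theorem Interlaced.two_rpow_mul_length_le {q C : ℝ} {x ω : ℕ → ℝ} (hω : Monotone ω)
    (hC : ∀ t, ω t ≤ C) (hx : ∀ a b, a ≤ b → |x b - x a| ^ q ≤ ω b - ω a) {N : ℕ}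
    {l l' : List ℕ} (h : Interlaced N l l') :
    (∀ t, N < t → x t = (l.count t : ℝ) - l'.count t) → 2 ^ q * l.length ≤ C - ω N := by
  have hgt : ∀ {N : ℕ} {l l' : List ℕ}, Interlaced N l l' →
      ∀ t ≤ N, l.count t = 0 ∧ l'.count t = 0 := by
    intro N l l' h
    induction h with
    | nil N => simp
    | cons hNn hnm _ ih =>
      intro t ht
      obtain ⟨h1, h2⟩ := ih t (by omega)
      rw [List.count_cons_of_ne (by omega), List.count_cons_of_ne (by omega)]
      exact ⟨h1, h2⟩
  induction h with
  | nil N => intro _; simpa using hC N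
  | @cons N n m l l' hNn hnm hll ih =>
    intro hxt
    have h1 := ih fun t ht => by
      rw [hxt t (by omega), List.count_cons_of_ne (by omega), List.count_cons_of_ne (by omega)]
    have hn : x n = 1 := by
      rw [hxt n hNn, List.count_cons_self, List.count_cons_of_ne (by omega), (hgt hll n hnm.le).1,
        (hgt hll n hnm.le).2]
      simp
    have hm : x m = -1 := by
      rw [hxt m (by omega), List.count_cons_self, List.count_cons_of_ne (by omega),
        (hgt hll m le_rfl).1, (hgt hll m le_rfl).2]
      simp
    have h2 := hx n m hnm.le
    rw [hn, hm, show |(-1 : ℝ) - 1| = 2 by norm_num] at h2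
    have h3 := hω hNn.le
    rw [List.length_cons]
    push_cast
    linarith

/-- The control rises once at `a` and once at `a + 1`, for the jump up and the jump down. -/
theorem hasControl_single {q : ℝ} (hq : 0 < q) (a : ℕ) :
    HasControl q 2 (fun t => if t = a then 1 else 0) := by
  refine ⟨fun t => (if a ≤ t then 1 else 0) + (if a < t then 1 else 0), ?_, ?_, ?_⟩
  · intro s t hst
    dsimp only
    split_ifs <;> first | omega | norm_num
  · intro t
    dsimp only
    split_ifs <;> norm_num
  · intro s t hst
    dsimp only
    split_ifs <;> first | omega | norm_num [Real.zero_rpow hq.ne']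

namespace JamesSpace

variable {p : ℝ} [hp : Fact (1 < p)]

theorem pos_exponent : 0 < p := one_pos.trans hp.out

theorem toSeq_sub (x y : JamesSpace p) : (x - y).toSeq = x.toSeq - y.toSeq := rfl

theorem hasControl (x : JamesSpace p) : HasControl p (‖x‖ ^ p) x.toSeq :=
  hasControl_of_bddAbove pos_exponent x.bddAbove

theorem norm_le_of_hasControl {C : ℝ} {x : JamesSpace p} (h : HasControl p C x.toSeq) :
    ‖x‖ ≤ C ^ (1 / p) :=
  csSup_le (jamesVariations_nonempty _ _) fun _ hs =>
    jamesVariations_le_of_hasControl pos_exponent h hs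

theorem abs_toSeq_sub_le_norm (x : JamesSpace p) {a b : ℕ} (hab : a < b) :
    |x.toSeq b - x.toSeq a| ≤ ‖x‖ := abs_sub_le_jamesNorm hp.out x.bddAbove hab

theorem abs_toSeq_le_norm (x : JamesSpace p) (t : ℕ) : |x.toSeq t| ≤ ‖x‖ := by
  have h : Tendsto (fun b => |x.toSeq b - x.toSeq t|) atTop (𝓝 |0 - x.toSeq t|) :=
    (x.tendsto.sub_const _).abs
  rw [zero_sub, abs_neg] at h
  exact le_of_tendsto h ((eventually_gt_atTop t).mono fun b hb => x.abs_toSeq_sub_le_norm hb)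

/-- The unit vectors of `J_p`. -/
def unitVector (p : ℝ) [hp : Fact (1 < p)] (a : ℕ) : JamesSpace p :=
  (⟨fun t => if t = a then 1 else 0, tendsto_const_nhds.congr'
      ((eventually_gt_atTop a).mono fun t ht => (if_neg (by omega)).symm),
    ⟨_, fun _ hs => jamesVariations_le_of_hasControl pos_exponent
      (hasControl_single pos_exponent a) hs⟩⟩ : jamesSubmodule p)

theorem toSeq_unitVector (a : ℕ) :
    (unitVector p a).toSeq = fun t => if t = a then 1 else 0 := rfl

theorem norm_unitVector_le (a : ℕ) : ‖unitVector p a‖ ≤ 2 :=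
  (norm_le_of_hasControl (hasControl_single pos_exponent a)).trans <|
    (Real.rpow_le_rpow_of_exponent_le one_le_two
      ((div_le_one pos_exponent).2 hp.out.le)).trans_eq (Real.rpow_one 2)

theorem one_le_norm_unitVector_sub {a b : ℕ} (hab : a ≠ b) :
    1 ≤ ‖unitVector p a - unitVector p b‖ := by
  have h := (unitVector p a - unitVector p b).abs_toSeq_le_norm a
  simpa [toSeq_sub, toSeq_unitVector, hab] using h

theorem norm_unitVector_sub_le (a b : ℕ) : ‖unitVector p a - unitVector p b‖ ≤ 4 := by
  linarith [norm_sub_le (unitVector p a) (unitVector p b), norm_unitVector_le (p := p) a,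
    norm_unitVector_le (p := p) b]

/-- The sum of the unit vectors indexed by the entries of a list. -/
def sumUnitVectors (p : ℝ) [hp : Fact (1 < p)] (l : List ℕ) : JamesSpace p :=
  (l.map (unitVector p)).sum

theorem sumUnitVectors_sub (l₁ l₂ : List ℕ) (n n' : ℕ) :
    sumUnitVectors p (l₁ ++ n :: l₂) - sumUnitVectors p (l₁ ++ n' :: l₂) =
      unitVector p n - unitVector p n' := by
  simp only [sumUnitVectors, List.map_append, List.map_cons, List.sum_append, List.sum_cons]
  abel

theorem toSeq_sumUnitVectors (l : List ℕ) (t : ℕ) :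
    (sumUnitVectors p l).toSeq t = l.count t := by
  induction l with
  | nil => simp [sumUnitVectors]; rfl
  | cons n l ih =>
    have e : sumUnitVectors p (n :: l) = unitVector p n + sumUnitVectors p l := by
      simp [sumUnitVectors]
    rw [e, toSeq_add, Pi.add_apply, ih, toSeq_unitVector, List.count_cons]
    by_cases h : t = n
    · simp [h, add_comm]
    · simp [h, Ne.symm h]

theorem two_mul_rpow_le_norm_sub {l l' : List ℕ} (h : Interlaced 0 l l') :
    2 * (l.length : ℝ) ^ (1 / p) ≤ ‖sumUnitVectors p l - sumUnitVectors p l'‖ := by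
  set x := sumUnitVectors p l - sumUnitVectors p l'
  have hp0 : 0 < p := pos_exponent
  obtain ⟨ω, hω, hωb, hωx⟩ := x.hasControl
  have h1 := h.two_rpow_mul_length_le hω (fun t => (hωb t).2) hωx fun t _ => by
    simp only [x, toSeq_sub, Pi.sub_apply, toSeq_sumUnitVectors]
  have h2 : 2 ^ p * (l.length : ℝ) ≤ ‖x‖ ^ p := by linarith [(hωb 0).1]
  have h3 := Real.rpow_le_rpow (by positivity) h2 (show 0 ≤ 1 / p by positivity)
  rwa [Real.mul_rpow (by positivity) (by positivity), ← Real.rpow_mul (by norm_num),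
    ← Real.rpow_mul (norm_nonneg x), mul_one_div_cancel hp0.ne', Real.rpow_one,
    Real.rpow_one] at h3

end JamesSpace

/-! ### Comparison of the growth rates `k^{1/q}` and `k^{1/p}` -/

theorem not_forall_mul_rpow_le {p q a b : ℝ} (hq : 0 < q) (hqp : q < p) (ha : 0 < a) :
    ¬ ∀ k : ℕ, 1 ≤ k → a * (k : ℝ) ^ (1 / q) ≤ b * (k : ℝ) ^ (1 / p) := by
  intro h
  have hs : 0 < 1 / q - 1 / p := sub_pos.2 (one_div_lt_one_div_of_lt hq hqp)
  have ht : Tendsto (fun k : ℕ => (k : ℝ) ^ (1 / q - 1 / p)) atTop atTop :=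
    (tendsto_rpow_atTop hs).comp tendsto_natCast_atTop_atTop
  obtain ⟨k, hk1, hk2⟩ := ((ht.eventually_gt_atTop (b / a)).and (eventually_ge_atTop 1)).exists
  have hk : (0 : ℝ) < k := by exact_mod_cast hk2
  rw [Real.rpow_sub hk, div_lt_div_iff₀ ha (by positivity)] at hk1
  linarith [h k hk2]

theorem corollaryC3 (p q : ℝ) [Fact (1 < p)] [Fact (1 < q)] (hqp : q < p) :
    ¬ CoarseLipschitzEmbeds (JamesSpace q) (JamesSpace p) := by
  rintro ⟨φ, θ, A, B, hθ, hA, hB, hφ⟩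
  have hp0 : 0 < p := JamesSpace.pos_exponent
  have hq0 : 0 < q := JamesSpace.pos_exponent
  -- Distinct unit vectors are at distance at least `1`, so scaling by `θ` puts adjacent points
  -- beyond the threshold.
  set e : List ℕ → JamesSpace q := fun l => θ • JamesSpace.sumUnitVectors q l with he
  have hdist : ∀ l l', dist (e l) (e l') =
      θ * ‖JamesSpace.sumUnitVectors q l - JamesSpace.sumUnitVectors q l'‖ := fun l l' => by
    rw [dist_eq_norm, he, ← smul_sub, norm_smul, Real.norm_of_nonneg hθ.le]
  set f : List ℕ → JamesSpace p := fun l => φ (e l) with hf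
  set r : ℝ := B * (θ * 4) with hr
  have hr0 : 0 ≤ r := by positivity
  have hadj : ∀ l₁ l₂ n n', ‖f (l₁ ++ n :: l₂) - f (l₁ ++ n' :: l₂)‖ ≤ r := by
    intro l₁ l₂ n n'
    rcases eq_or_ne n n' with rfl | hnn
    · simpa using hr0
    · have hd := hdist (l₁ ++ n :: l₂) (l₁ ++ n' :: l₂)
      rw [JamesSpace.sumUnitVectors_sub] at hd
      have h1 : θ ≤ dist (e (l₁ ++ n :: l₂)) (e (l₁ ++ n' :: l₂)) := by
        rw [hd]
        exact le_mul_of_one_le_right hθ.le (JamesSpace.one_le_norm_unitVector_sub hnn)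
      have h2 := (hφ _ _ h1).2
      rw [dist_eq_norm, hd] at h2
      refine h2.trans ?_
      have := JamesSpace.norm_unitVector_sub_le (p := q) n n'
      rw [hr]
      gcongr
  have hadjc : ∀ k, AdjacentControl p (r ^ p) r k (fun l => (f l).toSeq) := by
    intro k l₁ l₂ n n' _
    have h := hadj l₁ l₂ n n'
    refine ⟨?_, fun t => ?_⟩
    · obtain ⟨ω, hω, hωb, hωx⟩ := (f (l₁ ++ n :: l₂) - f (l₁ ++ n' :: l₂)).hasControl
      exact ⟨ω, hω, fun t => ⟨(hωb t).1, (hωb t).2.trans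
        (Real.rpow_le_rpow (norm_nonneg _) h hp0.le)⟩, hωx⟩
    · exact ((f (l₁ ++ n :: l₂) - f (l₁ ++ n' :: l₂)).abs_toSeq_le_norm t).trans h
  -- Entries are replaced by `0` one at a time. This bound may depend on `k`: it only makes the
  -- limits exist and does not enter `K`.
  have hbdd : ∀ k, ∃ S, ∀ l, l.length = k → ‖f l‖ ≤ S := by
    have key : ∀ (l l₀ : List ℕ), ‖f (l₀ ++ l)‖ ≤
        ‖f (l₀ ++ List.replicate l.length 0)‖ + l.length * r := by
      intro l
      induction l with
      | nil => simp
      | cons n l ih =>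
        intro l₀
        have h1 := ih (l₀ ++ [0])
        have h2 := hadj l₀ l n 0
        have h3 := norm_sub_norm_le (f (l₀ ++ n :: l)) (f (l₀ ++ 0 :: l))
        simp only [List.append_assoc, List.cons_append, List.nil_append] at h1
        rw [List.length_cons, List.replicate_succ]
        push_cast
        linarith
    exact fun k => ⟨_, fun l hl => by simpa only [List.nil_append, hl] using key l []⟩
  set K : ℝ := 1 + (2 * (2 * r + 3)) ^ p + 2 ^ p * (1 + 2 ^ p * (r ^ p + r ^ p)) with hK
  have hK0 : 0 ≤ K := by positivity
  refine not_forall_mul_rpow_le (p := p) (q := q) (a := A * (θ * 2)) (b := K ^ (1 / p)) hq0 hqp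
    (by positivity) fun k hk => ?_
  obtain ⟨S, hS⟩ := hbdd k
  obtain ⟨l, l', hll, hl, -, hc⟩ := exists_interlaced_hasControl_sub hp0 hr0 k
    (f := fun l => (f l).toSeq) (fun l hl t => ((f l).abs_toSeq_le_norm t).trans (hS l hl))
    (hadjc k)
  have hupper : ‖f l - f l'‖ ≤ (k * K) ^ (1 / p) := JamesSpace.norm_le_of_hasControl hc
  have hlow := JamesSpace.two_mul_rpow_le_norm_sub (p := q) hll
  rw [hl] at hlow
  have hk1 : (1 : ℝ) ≤ (k : ℝ) ^ (1 / q) :=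
    Real.one_le_rpow (by exact_mod_cast hk) (by positivity)
  have hbig : θ ≤ dist (e l) (e l') := by
    rw [hdist]
    exact le_mul_of_one_le_right hθ.le (by linarith)
  have h1 := (hφ _ _ hbig).1
  rw [hdist, dist_eq_norm] at h1
  calc A * (θ * 2) * (k : ℝ) ^ (1 / q) = A * (θ * (2 * (k : ℝ) ^ (1 / q))) := by ring
    _ ≤ A * (θ * ‖JamesSpace.sumUnitVectors q l - JamesSpace.sumUnitVectors q l'‖) := by gcongr
    _ ≤ ‖f l - f l'‖ := h1
    _ ≤ (k * K) ^ (1 / p) := hupper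
    _ = K ^ (1 / p) * (k : ℝ) ^ (1 / p) := by
      rw [Real.mul_rpow (by positivity) hK0, mul_comm]
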